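/- Let $A$ be a simplicial space, i.e. a contravariant functor from the simplex category $\Delta$ (objects $[n]=\{0,\dots,n\}$, $n\in\mathbb{N}$; morphisms the non-decreasing maps) to the category of topological spaces, and write $A_n:=A([n])$. Let $\Delta^n:=\{(t_0,\dots,t_n)\in\mathbb{R}^{n+1} : t_i\geq 0,\ \sum_i t_i=1\}$, and for a morphism $\delta:[n]\to[m]$ let $\Delta^*(\delta):\Delta^n\to\Delta^m$ be the map $(t_i)_{0\le i\le n}\mapsto\bigl(\sum_{i\in\delta^{-1}(j)}t_i\bigr)_{0\le j\le m}$. Let the thin geometric realization $|A|$ be the quotient space of $\coprod_{n\in\mathbb{N}}A_n\times\Delta^n$ by the equivalence relation generated by $(x,\Delta^*(\delta)(y))\sim(A(\delta)(x),y)$ for all $m,n\in\mathbb{N}$, $x\in A_m$, $y\in\Delta^n$ and all morphisms $\delta:[n]\to[m]$ of $\Delta$. If $A_n$ is Hausdorff for every $n\in\mathbb{N}$, then $|A|$ is Hausdorff. -/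

import Mathlib

open CategoryTheory Opposite
open scoped Simplicial

universe u

/-- The disjoint union `∐ₙ Aₙ × Δⁿ` attached to a simplicial space `A`, with the disjoint union
topology (of product topologies). Here `Δⁿ` is the set of vectors in `ℝⁿ⁺¹` with non-negative
coordinates of sum `1`. -/
abbrev RealizationCover (A : SimplicialObject TopCat.{u}) : Type u :=
  Σ n : ℕ, A.obj (op ⦋n⦌) × stdSimplex ℝ (Fin (n + 1))

/-- The simplicial identifications: `(x, Δ^*(δ)(y)) ∼ (A(δ)(x), y)` for `x ∈ Aₘ`, `y ∈ Δⁿ` and a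
morphism `δ : [n] ⟶ [m]` of the simplex category. The `j`-th coordinate of
`stdSimplex.map δ y` is the sum of the `y i` over all `i` with `δ i = j`. -/
inductive RealizationRel (A : SimplicialObject TopCat.{u}) :
    RealizationCover A → RealizationCover A → Prop where
  | glue {m n : ℕ} (δ : ⦋n⦌ ⟶ ⦋m⦌) (x : A.obj (op ⦋m⦌)) (y : stdSimplex ℝ (Fin (n + 1))) :
      RealizationRel A ⟨m, x, stdSimplex.map δ.toOrderHom y⟩ ⟨n, A.map δ.op x, y⟩

/-- The thin geometric realization `|A|` of a simplicial space `A`: the quotient of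
`∐ₙ Aₙ × Δⁿ` by the equivalence relation generated by the simplicial identifications. -/
def ThinRealization (A : SimplicialObject TopCat.{u}) : Type u :=
  Quot (RealizationRel A)

/-- `|A|` carries the quotient topology. -/
instance instTopologicalSpaceThinRealization (A : SimplicialObject TopCat.{u}) :
    TopologicalSpace (ThinRealization A) :=
  inferInstanceAs (TopologicalSpace (Quot (RealizationRel A)))

/-!
A point `t ∈ Δⁿ` cuts `[0, 1)` into consecutive intervals of lengths `t 0, …, t n`, that is, it
gives a monotone step function `block t : [0, 1) → {0, …, n}`, and `Δ^*(δ)(t)` has the step function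
`δ ∘ block t` (`block_map`). Hence every monotone sequence `u` of `k + 1` points of `[0, 1)` defines
a map of sets `sample A u : |A| → A_k`, sending the class of `(x, t)` to `A(block t ∘ u)(x)`.

These maps separate points. Given `p ≠ q`, the pairs of simultaneous values of their two step
functions form a finite chain, so `p` and `q` have representatives `(a, w)` and `(b, w)` over the
same interior point `w` of some `Δᵏ` (`exists_common_rep`); then `a ≠ b`, and sampling at one point
from each interval of `w` recovers `a` and `b`.

A single map `sample A u` is not continuous, since it may jump where a point of `u` is an endpoint
of an interval of `t`. The remedy is to choose `u` at random, so that for each fixed `t` this has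
probability zero. Then for `V ⊆ A_k` open the probability that the sample of `r` lies in `V` is a
lower semicontinuous function of `r ∈ |A|` (`isOpen_lt_measure_sample_mem`). If `V ∋ a` and `W ∋ b`
are disjoint open sets, the points whose sample lies in `V`, respectively in `W`, with probability
greater than one half form disjoint open neighbourhoods of `p` and `q`.
-/

open MeasureTheory Filter Topology

namespace ThinRealization

/-! ### Step functions attached to points of a simplex -/

section Block

variable {n : ℕ}

/-- The left endpoint of the `i`-th interval when `[0, 1)` is cut into consecutive intervals of
lengths `t 0, …, t n`. -/
def leftEnd (t : stdSimplex ℝ (Fin (n + 1))) (i : Fin (n + 1)) : ℝ := ∑ j ∈ Finset.Iio i, t j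

/-- The right endpoint of the `i`-th interval when `[0, 1)` is cut into consecutive intervals of
lengths `t 0, …, t n`. -/
def rightEnd (t : stdSimplex ℝ (Fin (n + 1))) (i : Fin (n + 1)) : ℝ := ∑ j ∈ Finset.Iic i, t j

lemma leftEnd_add (t : stdSimplex ℝ (Fin (n + 1))) (i : Fin (n + 1)) :
    leftEnd t i + t i = rightEnd t i := by
  rw [leftEnd, rightEnd, ← Finset.Iio_insert, Finset.sum_insert (by simp), add_comm]

lemma leftEnd_nonneg (t : stdSimplex ℝ (Fin (n + 1))) (i : Fin (n + 1)) : 0 ≤ leftEnd t i :=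
  Finset.sum_nonneg fun j _ => t.2.1 j

lemma sum_le_sum_of_subset (t : stdSimplex ℝ (Fin (n + 1))) {S T : Finset (Fin (n + 1))}
    (h : S ⊆ T) : ∑ j ∈ S, t j ≤ ∑ j ∈ T, t j :=
  Finset.sum_le_sum_of_subset_of_nonneg h fun j _ _ => t.2.1 j

lemma rightEnd_le_one (t : stdSimplex ℝ (Fin (n + 1))) (i : Fin (n + 1)) : rightEnd t i ≤ 1 :=
  (sum_le_sum_of_subset t (Finset.subset_univ _)).trans_eq t.2.2

lemma rightEnd_le_leftEnd (t : stdSimplex ℝ (Fin (n + 1))) {i j : Fin (n + 1)} (h : i < j) :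
    rightEnd t i ≤ leftEnd t j :=
  sum_le_sum_of_subset t fun _ hk => Finset.mem_Iio.2 ((Finset.mem_Iic.1 hk).trans_lt h)

lemma rightEnd_last (t : stdSimplex ℝ (Fin (n + 1))) : rightEnd t (Fin.last n) = 1 := by
  rw [← t.2.2, rightEnd]
  exact Finset.sum_congr (by ext j; simp [Fin.le_last]) fun _ _ => rfl

lemma continuous_leftEnd (i : Fin (n + 1)) :
    Continuous fun t : stdSimplex ℝ (Fin (n + 1)) => leftEnd t i :=
  continuous_finsetSum _ fun j _ => (continuous_apply j).comp continuous_subtype_val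

lemma continuous_rightEnd (i : Fin (n + 1)) :
    Continuous fun t : stdSimplex ℝ (Fin (n + 1)) => rightEnd t i :=
  continuous_finsetSum _ fun j _ => (continuous_apply j).comp continuous_subtype_val

/-- The step function `[0, 1) → {0, …, n}` attached to `t ∈ Δⁿ`: it takes the value `i` on the
half-open interval `[leftEnd t i, rightEnd t i)`, of length `t i`. -/
noncomputable def block (t : stdSimplex ℝ (Fin (n + 1))) :
    Set.Ico (0 : ℝ) 1 →o Fin (n + 1) where
  toFun u := sInf {j | (u : ℝ) < rightEnd t j}
  monotone' _ _ h := sInf_le_sInf fun _ hj => lt_of_le_of_lt (Subtype.coe_le_coe.2 h) hj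

lemma lt_rightEnd_block (t : stdSimplex ℝ (Fin (n + 1))) (u : Set.Ico (0 : ℝ) 1) :
    (u : ℝ) < rightEnd t (block t u) :=
  Set.Nonempty.csInf_mem (s := {j | (u : ℝ) < rightEnd t j})
    ⟨Fin.last n, by simpa [rightEnd_last] using u.2.2⟩ (Set.toFinite _)

lemma leftEnd_block_le (t : stdSimplex ℝ (Fin (n + 1))) (u : Set.Ico (0 : ℝ) 1) :
    leftEnd t (block t u) ≤ u := by
  rcases Fin.eq_zero_or_eq_succ (block t u) with h | ⟨j, h⟩
  · rw [h, leftEnd]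
    have : Finset.Iio (0 : Fin (n + 1)) = ∅ := by ext; simp
    simpa [this] using u.2.1
  · have h1 : leftEnd t j.succ = rightEnd t j.castSucc :=
      Finset.sum_congr (by ext i; simp [Fin.le_castSucc_iff]) fun _ _ => rfl
    rw [h, h1]
    by_contra! hlt
    have h2 : block t u ≤ j.castSucc := sInf_le (a := j.castSucc) hlt
    exact absurd h2 (by simp [h])

lemma block_eq_iff (t : stdSimplex ℝ (Fin (n + 1))) (u : Set.Ico (0 : ℝ) 1) (i : Fin (n + 1)) :
    block t u = i ↔ leftEnd t i ≤ u ∧ (u : ℝ) < rightEnd t i := by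
  refine ⟨?_, fun ⟨h1, h2⟩ => ?_⟩
  · rintro rfl
    exact ⟨leftEnd_block_le t u, lt_rightEnd_block t u⟩
  · rcases lt_trichotomy (block t u) i with h | h | h
    · have := rightEnd_le_leftEnd t h
      linarith [lt_rightEnd_block t u]
    · exact h
    · have := rightEnd_le_leftEnd t h
      linarith [leftEnd_block_le t u]

lemma map_apply {m : ℕ} (f : Fin (n + 1) → Fin (m + 1)) (t : stdSimplex ℝ (Fin (n + 1)))
    (j : Fin (m + 1)) : stdSimplex.map f t j = ∑ i with f i = j, t i := by
  rw [stdSimplex.map_coe, FunOnFinite.linearMap_apply_apply]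

lemma sum_map {m : ℕ} (f : Fin (n + 1) → Fin (m + 1)) (t : stdSimplex ℝ (Fin (n + 1)))
    (S : Finset (Fin (m + 1))) : ∑ j ∈ S, stdSimplex.map f t j = ∑ i with f i ∈ S, t i := by
  simp_rw [map_apply]
  rw [← Finset.sum_fiberwise_of_maps_to (s := Finset.univ.filter fun i => f i ∈ S) (t := S)
    (g := f) (by simp)]
  refine Finset.sum_congr rfl fun j hj => Finset.sum_congr ?_ fun _ _ => rfl
  ext i
  simp only [Finset.mem_filter, Finset.mem_univ, true_and]
  exact ⟨fun h => ⟨h ▸ hj, h⟩, fun h => h.2⟩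

/-- The step function of a pushforward is the composite of the step function with the map. -/
lemma block_map {m : ℕ} (f : Fin (n + 1) →o Fin (m + 1)) (t : stdSimplex ℝ (Fin (n + 1)))
    (u : Set.Ico (0 : ℝ) 1) : block (stdSimplex.map f t) u = f (block t u) := by
  rw [block_eq_iff, leftEnd, rightEnd, sum_map, sum_map]
  constructor
  · refine (sum_le_sum_of_subset t fun i hi => ?_).trans (leftEnd_block_le t u)
    simp only [Finset.mem_filter, Finset.mem_univ, true_and, Finset.mem_Iio] at hi ⊢
    exact f.monotone.reflect_lt hi
  · refine (lt_rightEnd_block t u).trans_le (sum_le_sum_of_subset t fun i hi => ?_)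
    simp only [Finset.mem_filter, Finset.mem_univ, true_and, Finset.mem_Iic] at hi ⊢
    exact f.monotone hi

lemma measurable_block (t : stdSimplex ℝ (Fin (n + 1))) : Measurable (block t) := by
  refine measurable_to_countable' fun i => ?_
  have : block t ⁻¹' {i} = Subtype.val ⁻¹' Set.Ico (leftEnd t i) (rightEnd t i) := by
    ext u
    exact block_eq_iff t u i
  rw [this]
  exact measurable_subtype_coe measurableSet_Ico

noncomputable instance : MeasureSpace (Set.Ico (0 : ℝ) 1) := Measure.Subtype.measureSpace

lemma volume_block_eq (t : stdSimplex ℝ (Fin (n + 1))) (i : Fin (n + 1)) :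
    volume.real (block t ⁻¹' {i}) = t i := by
  have : Subtype.val '' (block t ⁻¹' {i}) = Set.Ico (leftEnd t i) (rightEnd t i) := by
    ext u
    constructor
    · rintro ⟨u, hu, rfl⟩
      exact (block_eq_iff t u i).1 hu
    · intro hu
      exact ⟨⟨u, (leftEnd_nonneg t i).trans hu.1, hu.2.trans_le (rightEnd_le_one t i)⟩,
        (block_eq_iff t _ i).2 hu, rfl⟩
  rw [Measure.real, Measure.Subtype.volume_def,
    (MeasurableEmbedding.subtype_coe measurableSet_Ico).comap_apply, this, Real.volume_Ico,
    ← leftEnd_add, add_sub_cancel_left, ENNReal.toReal_ofReal]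
  exact t.2.1 i

/-- Away from the endpoints of the intervals, `block t u` is locally constant in `t`. -/
lemma eventually_block_eq (t : stdSimplex ℝ (Fin (n + 1))) (u : Set.Ico (0 : ℝ) 1)
    (h : ∀ i, (u : ℝ) ≠ leftEnd t i) : ∀ᶠ t' in 𝓝 t, block t' u = block t u := by
  have h1 := (continuous_leftEnd (block t u)).continuousAt.eventually_lt continuousAt_const
    (lt_of_le_of_ne (leftEnd_block_le t u) (h _).symm)
  have h2 := continuousAt_const.eventually_lt (continuous_rightEnd (block t u)).continuousAt
    (lt_rightEnd_block t u)
  filter_upwards [h1, h2] with t' h1 h2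
  exact (block_eq_iff _ _ _).2 ⟨h1.le, h2⟩

end Block

/-! ### Common subdivisions -/

section CommonSubdivision

variable {n m : ℕ}

instance : IsFiniteMeasure (volume : Measure (Set.Ico (0 : ℝ) 1)) :=
  ⟨by rw [Measure.Subtype.volume_univ measurableSet_Ico.nullMeasurableSet]; simp⟩

/-- Two points of simplices are pushforwards of one interior point `w` of a common simplex: the
vertices of that simplex are the pairs of values that the two step functions take simultaneously on
a set of positive length, and the coordinates of `w` are these lengths. -/
lemma exists_common_subdivision (t : stdSimplex ℝ (Fin (n + 1)))
    (t' : stdSimplex ℝ (Fin (m + 1))) :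
    ∃ (k : ℕ) (w : stdSimplex ℝ (Fin (k + 1))) (f : Fin (k + 1) →o Fin (n + 1))
      (g : Fin (k + 1) →o Fin (m + 1)),
      (∀ i, 0 < w i) ∧ stdSimplex.map f w = t ∧ stdSimplex.map g w = t' := by
  classical
  let F : Set.Ico (0 : ℝ) 1 → Fin (n + 1) × Fin (m + 1) := fun u => (block t u, block t' u)
  have hF : Measurable F := (measurable_block t).prodMk (measurable_block t')
  let μ : Fin (n + 1) ×ₗ Fin (m + 1) → ℝ := fun z => volume.real (F ⁻¹' {ofLex z})
  let S : Finset (Fin (n + 1) ×ₗ Fin (m + 1)) := Finset.univ.filter fun z => 0 < μ z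
  -- The length of any set of the form `{F ∈ T}` is the sum of the lengths of the fibres in `S`.
  have hsum : ∀ T : Finset (Fin (n + 1) × Fin (m + 1)),
      ∑ z ∈ S with ofLex z ∈ T, μ z = volume.real (F ⁻¹' T) := by
    intro T
    have h1 : volume.real (F ⁻¹' T) = ∑ z ∈ T, volume.real (F ⁻¹' {z}) := by
      rw [sum_measureReal_preimage_singleton _ (fun z _ => hF (measurableSet_singleton z))]
    rw [h1, Finset.sum_bij_ne_zero (t := T) (g := fun z => volume.real (F ⁻¹' {z}))
      (fun z _ _ => ofLex z)]
    · exact fun z hz _ => (Finset.mem_filter.1 hz).2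
    · exact fun _ _ _ _ _ _ h => ofLex.injective h
    · intro z hz hne
      have hpos : 0 < μ (toLex z) := lt_of_le_of_ne measureReal_nonneg hne.symm
      exact ⟨toLex z, by simp [S, hpos, hz], hne, rfl⟩
    · exact fun _ _ _ => rfl
  -- Values of a monotone map into the product form a chain.
  have hmono : ∀ z ∈ S, ∀ z' ∈ S, z ≤ z' →
      (ofLex z).1 ≤ (ofLex z').1 ∧ (ofLex z).2 ≤ (ofLex z').2 := by
    have hne : ∀ z ∈ S, ∃ u, F u = ofLex z := fun z hz => by
      by_contra! h
      have h0 : F ⁻¹' {ofLex z} = ∅ := by ext u; simpa using h u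
      have := (Finset.mem_filter.1 hz).2
      simp [μ, h0] at this
    intro z hz z' hz' h
    obtain ⟨u, hu⟩ := hne z hz
    obtain ⟨v, hv⟩ := hne z' hz'
    rcases le_total u v with huv | huv
    · rw [← hu, ← hv]
      exact ⟨(block t).monotone huv, (block t').monotone huv⟩
    · have h2 : z' ≤ z := by
        have : ofLex z' ≤ ofLex z := by
          rw [← hu, ← hv]
          exact ⟨(block t).monotone huv, (block t').monotone huv⟩
        exact Prod.Lex.toLex_mono this
      rw [le_antisymm h h2]
      exact ⟨le_rfl, le_rfl⟩
  have htot : ∑ z ∈ S, μ z = 1 := by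
    have h := hsum Finset.univ
    simp only [Finset.mem_univ, Finset.filter_true, Finset.coe_univ, Set.preimage_univ] at h
    rw [h, Measure.real, Measure.Subtype.volume_univ measurableSet_Ico.nullMeasurableSet]
    simp
  have hcard : S.card = (S.card - 1) + 1 := by
    have : S.Nonempty := by
      rw [Finset.nonempty_iff_ne_empty]
      intro h
      simp [h] at htot
    have := this.card_pos
    omega
  let e : Fin (S.card - 1 + 1) ≃o S := S.orderIsoOfFin hcard
  have he : ∀ p : Fin (n + 1) ×ₗ Fin (m + 1) → Prop, ∀ [DecidablePred p],
      ∑ i with p (e i), μ (e i) = ∑ z ∈ S with p z, μ z := by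
    intro p _
    rw [Finset.sum_filter, Finset.sum_filter, ← Finset.sum_coe_sort S]
    exact e.toEquiv.sum_comp fun z : S => if p z then μ z else 0
  refine ⟨S.card - 1, ⟨fun i => μ (e i), fun i => measureReal_nonneg, ?_⟩,
    ⟨fun i => (ofLex (e i : Fin (n + 1) ×ₗ Fin (m + 1))).1,
      fun i j h => (hmono _ (e i).2 _ (e j).2 (e.monotone h)).1⟩,
    ⟨fun i => (ofLex (e i : Fin (n + 1) ×ₗ Fin (m + 1))).2,
      fun i j h => (hmono _ (e i).2 _ (e j).2 (e.monotone h)).2⟩, ?_, ?_, ?_⟩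
  · have := he fun _ => True
    simpa [htot] using this
  · exact fun i => (Finset.mem_filter.1 (e i).2).2
  · ext j
    rw [map_apply, ← volume_block_eq t j]
    have h := hsum (Finset.univ.filter fun z => z.1 = j)
    refine (he fun z => (ofLex z).1 = j).trans ?_
    simp only [Finset.mem_filter, Finset.mem_univ, true_and] at h
    rw [h]
    congr 1
    ext u
    simp [F]
  · ext j
    rw [map_apply, ← volume_block_eq t' j]
    have h := hsum (Finset.univ.filter fun z => z.2 = j)
    refine (he fun z => (ofLex z).2 = j).trans ?_
    simp only [Finset.mem_filter, Finset.mem_univ, true_and] at h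
    rw [h]
    congr 1
    ext u
    simp [F]

end CommonSubdivision

/-! ### Sampling points of the realization -/

section Sample

variable (A : SimplicialObject TopCat.{u}) {k : ℕ}

/-- The map `|A| → A_k` that samples a point at a monotone sequence `u` of `k + 1` points of
`[0, 1)`: the class of `(x, t)` is sent to `A(δ)(x)`, where `δ = block t ∘ u`. -/
noncomputable def sample (u : Fin (k + 1) →o Set.Ico (0 : ℝ) 1) :
    ThinRealization A → A.obj (op ⦋k⦌) :=
  Quot.lift (fun p => A.map (SimplexCategory.mkHom
    ((block p.2.2).comp u)).op p.2.1) <| by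
      rintro _ _ ⟨δ, x, y⟩
      have h : SimplexCategory.mkHom ((block (stdSimplex.map δ.toOrderHom y)).comp u) =
          SimplexCategory.mkHom ((block y).comp u) ≫ δ := by
        ext i : 3
        exact block_map δ.toOrderHom y (u i)
      simp only [h, op_comp, A.map_comp]
      rfl

variable {A}

lemma mk_map {n : ℕ} (f : Fin (k + 1) →o Fin (n + 1)) (x : A.obj (op ⦋n⦌))
    (w : stdSimplex ℝ (Fin (k + 1))) :
    (Quot.mk _ ⟨n, x, stdSimplex.map f w⟩ : ThinRealization A) =
      Quot.mk _ ⟨k, A.map (SimplexCategory.mkHom f).op x, w⟩ :=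
  Quot.sound (RealizationRel.glue (SimplexCategory.mkHom f) x w)

/-- Any two points of `|A|` have representatives over the same interior point of a simplex. -/
lemma exists_common_rep (p q : ThinRealization A) :
    ∃ (k : ℕ) (w : stdSimplex ℝ (Fin (k + 1))) (a b : A.obj (op ⦋k⦌)), (∀ i, 0 < w i) ∧
      p = Quot.mk _ ⟨k, a, w⟩ ∧ q = Quot.mk _ ⟨k, b, w⟩ := by
  obtain ⟨⟨n, x, t⟩, rfl⟩ := Quot.exists_rep p
  obtain ⟨⟨m, y, t'⟩, rfl⟩ := Quot.exists_rep q
  obtain ⟨k, w, f, g, hw, rfl, rfl⟩ := exists_common_subdivision t t'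
  exact ⟨k, w, _, _, hw, mk_map f x w, mk_map g y w⟩

lemma sample_mk_of_block_eq (w : stdSimplex ℝ (Fin (k + 1))) (u : Fin (k + 1) →o Set.Ico (0 : ℝ) 1)
    (h : ∀ i, block w (u i) = i) (a : A.obj (op ⦋k⦌)) :
    sample A u (Quot.mk _ ⟨k, a, w⟩) = a := by
  have h' : SimplexCategory.mkHom ((block w).comp u) = 𝟙 _ := by
    ext i : 3
    exact h i
  change A.map (SimplexCategory.mkHom ((block w).comp u)).op a = a
  rw [h', op_id, A.map_id]
  rfl

section RandomSample

variable {Ω : Type*} [MeasurableSpace Ω] {u : Ω → Fin (k + 1) →o Set.Ico (0 : ℝ) 1}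

lemma measurableSet_block_comp_mem (hu : ∀ i, Measurable fun s => u s i) {n : ℕ}
    (t : stdSimplex ℝ (Fin (n + 1))) (G : Set (Fin (k + 1) →o Fin (n + 1))) :
    MeasurableSet {s | (block t).comp (u s) ∈ G} := by
  have h : Measurable fun s i => block t (u s i) :=
    measurable_pi_lambda _ fun i => (measurable_block t).comp (hu i)
  convert h (DFunLike.coe '' G).toFinite.measurableSet using 1
  ext s
  exact (DFunLike.coe_injective.mem_set_image (a := (block t).comp (u s))).symm

/-- Measurability needs no assumption on `V`, as the sample of a fixed point takes only finitely
many values. -/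
lemma measurableSet_sample_mem (hu : ∀ i, Measurable fun s => u s i) (r : ThinRealization A)
    (V : Set (A.obj (op ⦋k⦌))) : MeasurableSet {s | sample A (u s) r ∈ V} := by
  obtain ⟨⟨n, x, t⟩, rfl⟩ := Quot.exists_rep r
  exact measurableSet_block_comp_mem hu t {δ | A.map (SimplexCategory.mkHom δ).op x ∈ V}

/-- Sampling at a random sequence is lower semicontinuous in law. For `(x', t')` near `(x, t)`, the
map `block t' ∘ u` differs from `block t ∘ u` only with small probability, since almost surely no
point of `u` is an endpoint of an interval of `t`; and the finitely many conditions
`A(δ)(x) ∈ V` that hold at `x` persist at `x'`. -/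
lemma isOpen_lt_measure_sample_mem (μ : Measure Ω) [IsFiniteMeasure μ]
    (hu : ∀ i, Measurable fun s => u s i) (hne : ∀ i (v : ℝ), ∀ᵐ s ∂μ, (u s i : ℝ) ≠ v)
    {V : Set (A.obj (op ⦋k⦌))} (hV : IsOpen V) (c : ENNReal) :
    IsOpen {r | c < μ {s | sample A (u s) r ∈ V}} := by
  refine isOpen_coinduced.2 (isOpen_sigma_iff.2 fun n => isOpen_iff_mem_nhds.2 ?_)
  rintro ⟨x, t⟩ hxt
  let G : Set (Fin (k + 1) →o Fin (n + 1)) := {δ | A.map (SimplexCategory.mkHom δ).op x ∈ V}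
  have hlim : Tendsto (fun t' => μ {s | (block t').comp (u s) ∈ G}) (𝓝 t)
      (𝓝 (μ {s | (block t).comp (u s) ∈ G})) := by
    refine tendsto_measure_of_ae_tendsto_indicator_of_isFiniteMeasure _
      (measurableSet_block_comp_mem hu t G) (fun t' => measurableSet_block_comp_mem hu t' G) ?_
    filter_upwards [ae_all_iff.2 fun i => ae_all_iff.2 fun j => hne i (leftEnd t j)] with s hs
    filter_upwards [eventually_all.2 fun i => eventually_block_eq t (u s i) (hs i)] with t' ht'
    have h : (block t').comp (u s) = (block t).comp (u s) := OrderHom.ext _ _ (funext ht')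
    simp only [h]
  have h1 : ∀ᶠ t' in 𝓝 t, c < μ {s | (block t').comp (u s) ∈ G} := hlim.eventually_const_lt hxt
  have h2 : ∀ᶠ x' in 𝓝 x, ∀ δ ∈ G, A.map (SimplexCategory.mkHom δ).op x' ∈ V := by
    have : Finite (Fin (k + 1) →o Fin (n + 1)) := DFunLike.finite _
    refine G.toFinite.eventually_all.2 fun δ hδ => ?_
    exact (A.map (SimplexCategory.mkHom δ).op).hom.continuous.continuousAt.preimage_mem_nhds
      (hV.mem_nhds hδ)
  rw [nhds_prod_eq]
  filter_upwards [h2.prod_mk h1] with ⟨x', t'⟩ ⟨hx', ht'⟩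
  exact ht'.trans_le (measure_mono fun s hs => hx' _ hs)

end RandomSample

end Sample

/-! ### Random points in the intervals of an interior point -/

section Probe

variable {k : ℕ}

/-- The sequence with one point in the left half of each interval of `w`, at relative position
`s / 2`. -/
noncomputable def probe (w : stdSimplex ℝ (Fin (k + 1))) (hw : ∀ i, 0 < w i) (s : unitInterval) :
    Fin (k + 1) →o Set.Ico (0 : ℝ) 1 where
  toFun i := ⟨leftEnd w i + s * (w i / 2), by
    have h1 := leftEnd_nonneg w i
    have h2 := hw i
    have h3 := s.2.1
    positivity, by
    have h1 := leftEnd_add w i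
    have h2 := rightEnd_le_one w i
    nlinarith [hw i, s.2.2]⟩
  monotone' := by
    refine monotone_iff_forall_lt.2 fun i j h => ?_
    have h1 := rightEnd_le_leftEnd w h
    have h2 := leftEnd_add w i
    have h3 : 0 ≤ (s : ℝ) * (w j / 2) := mul_nonneg s.2.1 (half_pos (hw j)).le
    refine Subtype.mk_le_mk.2 ?_
    nlinarith [hw i, s.2.2]

lemma coe_probe (w : stdSimplex ℝ (Fin (k + 1))) (hw : ∀ i, 0 < w i) (s : unitInterval)
    (i : Fin (k + 1)) : (probe w hw s i : ℝ) = leftEnd w i + s * (w i / 2) := rfl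

lemma block_probe (w : stdSimplex ℝ (Fin (k + 1))) (hw : ∀ i, 0 < w i) (s : unitInterval)
    (i : Fin (k + 1)) : block w (probe w hw s i) = i := by
  rw [block_eq_iff, coe_probe, ← leftEnd_add]
  have h : 0 ≤ (s : ℝ) * (w i / 2) := mul_nonneg s.2.1 (half_pos (hw i)).le
  constructor
  · linarith
  · nlinarith [hw i, s.2.2]

lemma measurable_probe (w : stdSimplex ℝ (Fin (k + 1))) (hw : ∀ i, 0 < w i) (i : Fin (k + 1)) :
    Measurable fun s => probe w hw s i :=
  Measurable.subtype_mk (by fun_prop)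

lemma ae_probe_ne (w : stdSimplex ℝ (Fin (k + 1))) (hw : ∀ i, 0 < w i) (i : Fin (k + 1)) (v : ℝ) :
    ∀ᵐ s : unitInterval, (probe w hw s i : ℝ) ≠ v := by
  have hsub : {s | (probe w hw s i : ℝ) = v}.Subsingleton := by
    intro s hs s' hs'
    have h : leftEnd w i + s * (w i / 2) = leftEnd w i + s' * (w i / 2) := hs.trans hs'.symm
    exact Subtype.ext (mul_right_cancel₀ (half_pos (hw i)).ne' (add_left_cancel h))
  simpa [ae_iff] using hsub.measure_zero volume

lemma volume_sample_probe_mem {A : SimplicialObject TopCat.{u}} (w : stdSimplex ℝ (Fin (k + 1)))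
    (hw : ∀ i, 0 < w i) {a : A.obj (op ⦋k⦌)} {V : Set (A.obj (op ⦋k⦌))} (ha : a ∈ V) :
    volume {s | sample A (probe w hw s) (Quot.mk _ ⟨k, a, w⟩) ∈ V} = 1 := by
  have h : {s | sample A (probe w hw s) (Quot.mk _ ⟨k, a, w⟩) ∈ V} = Set.univ :=
    Set.eq_univ_of_forall fun s => by
      change sample A _ _ ∈ V
      rwa [sample_mk_of_block_eq w _ (block_probe w hw s)]
  rw [h, measure_univ]

end Probe

end ThinRealization

open ThinRealization in
theorem theorem1 (A : SimplicialObject TopCat.{u})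
    (hA : ∀ n : ℕ, T2Space (A.obj (op ⦋n⦌))) :
    T2Space (ThinRealization A) := by
  refine ⟨fun p q hpq => ?_⟩
  obtain ⟨k, w, a, b, hw, rfl, rfl⟩ := exists_common_rep p q
  have hab : a ≠ b := by
    rintro rfl
    exact hpq rfl
  obtain ⟨V, W, hV, hW, haV, hbW, hVW⟩ := (hA k).t2 hab
  -- In each of these open sets the sample lies in the given set with probability above one half.
  refine ⟨{r | 2⁻¹ < volume {s | sample A (probe w hw s) r ∈ V}},
    {r | 2⁻¹ < volume {s | sample A (probe w hw s) r ∈ W}},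
    isOpen_lt_measure_sample_mem volume (measurable_probe w hw) (ae_probe_ne w hw) hV 2⁻¹,
    isOpen_lt_measure_sample_mem volume (measurable_probe w hw) (ae_probe_ne w hw) hW 2⁻¹,
    ?_, ?_, Set.disjoint_left.2 fun r hrV hrW => ?_⟩
  · exact ENNReal.one_half_lt_one.trans_eq (volume_sample_probe_mem w hw haV).symm
  · exact ENNReal.one_half_lt_one.trans_eq (volume_sample_probe_mem w hw hbW).symm
  · have hdisj : Disjoint {s | sample A (probe w hw s) r ∈ V} {s | sample A (probe w hw s) r ∈ W} :=
      hVW.preimage fun s => sample A (probe w hw s) r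
    have hle := prob_le_one (μ := (volume : Measure unitInterval))
      (s := {s | sample A (probe w hw s) r ∈ V} ∪ {s | sample A (probe w hw s) r ∈ W})
    rw [measure_union hdisj (measurableSet_sample_mem (measurable_probe w hw) r W)] at hle
    refine absurd hle (not_le_of_gt ?_)
    calc (1 : ENNReal) = 2⁻¹ + 2⁻¹ := ENNReal.inv_two_add_inv_two.symm
      _ < _ := ENNReal.add_lt_add hrV hrW
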